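/- Let $G=(V,E,\Theta)$ be a weighted graph with $n=|V|$ vertices and real weights $\theta_{jk}=\theta_{kj}$ (zero off the edges), with weighted graph state $|G\rangle=\big[\prod_{(j,k)\in E}\Lambda_{jk}(\theta_{jk})\big]|+\rangle^{\otimes n}$, where $|+\rangle=(|0\rangle+|1\rangle)/\sqrt2$ and $\Lambda_{jk}(\theta)=|0\rangle\langle0|_j\otimes I_k+|1\rangle\langle1|_j\otimes(|0\rangle\langle0|_k+e^{i\theta}|1\rangle\langle1|_k)$. Let $\mathscr A=\{A_1,\dots,A_m\}$, $m\ge1$, be pairwise disjoint independent sets of vertices with union $V$, and let $h\ge1$ and $N\ge1$ be integers. For $\alpha\in\mathbb R$ put $|\alpha\rangle=(|0\rangle+e^{i\alpha}|1\rangle)/\sqrt2$. For $1\le l\le m$, $z\in\{0,1\}^{V\setminus A_l}$ and $k\in A_l$, let $\alpha_k(z)=\sum_{j\sim k}\theta_{jk}z_j$ (sum over the neighbours of $k$), and let $\alpha_k^h(z)$ be the multiple $\frac{c\pi}{h}$, $c\in\mathbb Z$, with $\frac{c\pi}{h}-\frac{\pi}{2h}\le\alpha_k(z)<\frac{c\pi}{h}+\frac{\pi}{2h}$.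 Let $$P_{l;h}=\sum_{z}\Big(\bigotimes_{k\in A_l}|\alpha_k^h(z)\rangle\langle\alpha_k^h(z)|\Big)\otimes|z\rangle\langle z|_{V\setminus A_l},\qquad \Omega_h(\mathscr A)=\frac1m\sum_{l=1}^mP_{l;h}.$$ In the $N$-random sampling test of an operator $0\le\Omega\le I$, applied to an arbitrary joint state of $N+1$ copies of the $n$-qubit system (no i.i.d. assumption), $N$ of the $N+1$ copies are chosen uniformly at random and the POVM $\{\Omega,I-\Omega\}$ is applied to each of them; the test is passed if all $N$ outcomes correspond to $\Omega$, and then $\sigma$ denotes the state of the remaining copy, conditioned on passing. A property of $\sigma$ is said to hold with significance level $\beta$ if it holds for every joint state of the $N+1$ copies that passes the test with probability at least $\beta$. Assume $\beta\ge\frac1{N+1}$. Then the state $|G\rangle^{\otimes(N+1)}$ passes the $N$-random sampling test of $\Omega_h(\mathscr A)$ with probability at least $\big(1-\sin^2\frac{\pi}{4h}\big)^{N\max_l|A_l|}$. Moreover, when this test is passed, the resultant state $\sigma$ satisfies $$\langle G|\sigma|G\rangle\ \ge\ 1-\Big[\frac{m(1-\beta)}{\beta N}+n\sin\frac{\pi}{4h}\Big]$$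 with significance level $\beta$. -/

import Mathlib

open Matrix
open scoped ComplexOrder

noncomputable section

/-! Operators on registers. A register with sites `ι`, each with computational basis `X`, has the
computational basis `ι → X`; operators are complex matrices in this basis. -/

/-- The tensor product operator `⊗ᵢ M i`. -/
def tensorOp {ι X : Type*} [Fintype ι] (M : ι → Matrix X X ℂ) : Matrix (ι → X) (ι → X) ℂ :=
  Matrix.of fun x y => ∏ i, M i (x i) (y i)

/-- The product vector `⊗ᵢ ψ i`. -/
def tensorVec {ι X : Type*} [Fintype ι] (ψ : ι → X → ℂ) : (ι → X) → ℂ :=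
  fun x => ∏ i, ψ i (x i)

/-- The rank-one operator `|ψ⟩⟨ψ|`. -/
def ketBra {X : Type*} (ψ : X → ℂ) : Matrix X X ℂ :=
  Matrix.vecMulVec ψ (star ψ)

/-- Density operators: positive semidefinite operators of trace one. -/
def IsDensity {X : Type*} [Fintype X] (ρ : Matrix X X ℂ) : Prop :=
  ρ.PosSemidef ∧ ρ.trace = 1

/-- The computational basis vectors `|0⟩`, `|1⟩` of a qubit. -/
def basisKet (a : Fin 2) : Fin 2 → ℂ := Pi.single a 1

/-- The qubit vector `|α⟩ = (|0⟩ + e^{iα} |1⟩) / √2`. -/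
def phaseKet (α : ℝ) : Fin 2 → ℂ :=
  fun a => (1 / (Real.sqrt 2 : ℂ)) *
    (basisKet 0 a + Complex.exp (Complex.I * (α : ℂ)) * basisKet 1 a)

/-- The qubit vector `|+⟩ = (|0⟩ + |1⟩) / √2`. -/
def plusKet : Fin 2 → ℂ :=
  fun a => (1 / (Real.sqrt 2 : ℂ)) * (basisKet 0 a + basisKet 1 a)

section Graph

variable {V : Type*} [Fintype V] [DecidableEq V]

/-- The single-qubit operator `M` acting on qubit `j` (identity on all others). -/
def onQubit (j : V) (M : Matrix (Fin 2) (Fin 2) ℂ) : Matrix (V → Fin 2) (V → Fin 2) ℂ :=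
  tensorOp (Function.update (fun _ => 1) j M)

/-- The controlled-Z rotation
`Λ_{jk}(θ) = |0⟩⟨0|_j ⊗ I_k + |1⟩⟨1|_j ⊗ (|0⟩⟨0|_k + e^{iθ} |1⟩⟨1|_k)`. -/
def controlledPhase (θ : ℝ) (j k : V) : Matrix (V → Fin 2) (V → Fin 2) ℂ :=
  onQubit j (ketBra (basisKet 0)) +
    onQubit j (ketBra (basisKet 1)) *
      onQubit k (ketBra (basisKet 0) +
        Complex.exp (Complex.I * (θ : ℂ)) • ketBra (basisKet 1))

theorem onQubit_diagonal (j : V) (d : Fin 2 → ℂ) :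
    onQubit j (Matrix.diagonal d) = Matrix.diagonal fun x : V → Fin 2 => d (x j) := by
  ext x y
  simp only [onQubit, tensorOp, Matrix.of_apply]
  rw [← Finset.mul_prod_erase Finset.univ _ (Finset.mem_univ j), Function.update_self]
  have h1 : ∏ i ∈ Finset.univ.erase j,
      Function.update (fun _ : V => (1 : Matrix (Fin 2) (Fin 2) ℂ)) j (Matrix.diagonal d) i
        (x i) (y i) =
      ∏ i ∈ Finset.univ.erase j, (1 : Matrix (Fin 2) (Fin 2) ℂ) (x i) (y i) := by
    refine Finset.prod_congr rfl fun i hi => ?_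
    rw [Function.update_of_ne (Finset.ne_of_mem_erase hi)]
  rw [h1]
  by_cases hxy : x = y
  · subst hxy
    simp
  · rw [Matrix.diagonal_apply_ne _ hxy]
    obtain ⟨i, hi⟩ := Function.ne_iff.mp hxy
    by_cases hij : i = j
    · subst hij
      rw [Matrix.diagonal_apply_ne _ hi, zero_mul]
    · have h0 : ∏ i ∈ Finset.univ.erase j, (1 : Matrix (Fin 2) (Fin 2) ℂ) (x i) (y i) = 0 :=
        Finset.prod_eq_zero (i := i) (Finset.mem_erase.mpr ⟨hij, Finset.mem_univ i⟩)
          (Matrix.one_apply_ne hi)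
      rw [h0, mul_zero]

theorem ketBra_basisKet (a : Fin 2) : ketBra (basisKet a) = Matrix.diagonal (basisKet a) := by
  ext x y
  fin_cases a <;> fin_cases x <;> fin_cases y <;>
    simp [ketBra, basisKet, Matrix.vecMulVec_apply]

/-- The gate is diagonal in the computational basis. -/
theorem controlledPhase_eq_diagonal (θ : ℝ) (j k : V) :
    controlledPhase θ j k = Matrix.diagonal fun x : V → Fin 2 =>
      if x j = 1 ∧ x k = 1 then Complex.exp (Complex.I * (θ : ℂ)) else 1 := by
  have h2 : ketBra (basisKet 0) + Complex.exp (Complex.I * (θ : ℂ)) • ketBra (basisKet 1) =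
      Matrix.diagonal (basisKet 0 + Complex.exp (Complex.I * (θ : ℂ)) • basisKet 1) := by
    rw [ketBra_basisKet, ketBra_basisKet, ← Matrix.diagonal_smul, Matrix.diagonal_add]
    rfl
  rw [controlledPhase, h2, ketBra_basisKet, ketBra_basisKet, onQubit_diagonal, onQubit_diagonal,
    onQubit_diagonal, Matrix.diagonal_mul_diagonal, Matrix.diagonal_add]
  congr 1
  funext x
  have hj : x j = 0 ∨ x j = 1 := by omega
  have hk : x k = 0 ∨ x k = 1 := by omega
  rcases hj with hj | hj <;> rcases hk with hk | hk <;> simp [hj, hk, basisKet]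

theorem controlledPhase_symm (θ : ℝ) (j k : V) :
    controlledPhase θ j k = controlledPhase θ k j := by
  simp only [controlledPhase_eq_diagonal, and_comm]

/-- The controlled-Z rotation acting on the two ends of an (unordered) pair of vertices. -/
def edgeGate (θ : ℝ) (e : Sym2 V) : Matrix (V → Fin 2) (V → Fin 2) ℂ :=
  Sym2.lift ⟨fun j k => controlledPhase θ j k, controlledPhase_symm θ⟩ e

theorem edgeGate_commute (θ θ' : ℝ) (e e' : Sym2 V) :
    Commute (edgeGate θ e) (edgeGate θ' e') := by
  induction e using Sym2.ind with
  | _ j k =>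
    induction e' using Sym2.ind with
    | _ j' k' =>
      simp only [edgeGate, Sym2.lift_mk, controlledPhase_eq_diagonal, commute_iff_eq,
        Matrix.diagonal_mul_diagonal, mul_comm]

/-- A weighted graph: a simple graph with a real weight on every unordered pair of vertices,
vanishing off the edges. -/
structure WeightedGraph (V : Type*) where
  graph : SimpleGraph V
  weight : Sym2 V → ℝ
  weight_eq_zero : ∀ e, e ∉ graph.edgeSet → weight e = 0

open Classical in
/-- The weighted graph state `|G⟩ = (∏_{(j,k) ∈ E} Λ_{jk}(θ_{jk})) |+⟩^{⊗ n}`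
(the factors of the product commute). -/
def WeightedGraph.state (G : WeightedGraph V) : (V → Fin 2) → ℂ :=
  (Finset.univ.filter fun e : Sym2 V => e ∈ G.graph.edgeSet).noncommProd
      (fun e => edgeGate (G.weight e) e)
      (fun e _ e' _ _ => edgeGate_commute (G.weight e) (G.weight e') e e') *ᵥ
    tensorVec fun _ : V => plusKet

/-- An independence cover `A₁, …, A_m` of the vertex set with pairwise disjoint members. -/
structure IsIndependenceCover (G : WeightedGraph V) {m : ℕ} (A : Fin m → Finset V) : Prop where
  indep : ∀ l, G.graph.IsIndepSet (A l : Set V)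
  cover : ∀ v, ∃ l, v ∈ A l
  disjoint : ∀ l l', l ≠ l' → Disjoint (A l) (A l')

open Classical in
/-- The angle `α_k(z) = ∑_{j ∈ C_k} θ_{jk} z_j`, given the outcomes `z` of the `Z`-measurements
outside `B`. For `k ∈ B` with `B` independent, all neighbours of `k` lie outside `B`. -/
def WeightedGraph.angle (G : WeightedGraph V) (B : Finset V) (z : {j : V // j ∉ B} → Fin 2)
    (k : V) : ℝ :=
  ∑ j ∈ Finset.univ.filter (fun j : {j : V // j ∉ B} => G.graph.Adj j.1 k),
    G.weight s(j.1, k) * ((z j : ℕ) : ℝ)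

/-- The multiple `c π / h` (`c` an integer) of `π / h` with
`c π / h - π / (2h) ≤ α < c π / h + π / (2h)`. -/
def roundAngle (h : ℕ) (α : ℝ) : ℝ :=
  (⌊α * h / Real.pi + 1 / 2⌋ : ℝ) * Real.pi / h

theorem roundAngle_spec {h : ℕ} (hh : 0 < h) (α : ℝ) :
    roundAngle h α - Real.pi / (2 * h) ≤ α ∧ α < roundAngle h α + Real.pi / (2 * h) := by
  have hpos : (0 : ℝ) < h := by exact_mod_cast hh
  have hpi := Real.pi_pos
  have h1 := Int.floor_le (α * h / Real.pi + 1 / 2)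
  have h2 := Int.lt_floor_add_one (α * h / Real.pi + 1 / 2)
  have e : α = (α * h / Real.pi) * (Real.pi / h) := by field_simp
  have hp : 0 < Real.pi / h := by positivity
  have e1 : roundAngle h α = (⌊α * h / Real.pi + 1 / 2⌋ : ℝ) * (Real.pi / h) := by
    rw [roundAngle, mul_div_assoc]
  have e2 : Real.pi / (2 * h) = 1 / 2 * (Real.pi / h) := by field_simp
  rw [e1, e2]
  constructor
  · nlinarith
  · nlinarith

/-- The operator of the adaptive test for `B`: measure the qubits outside `B` in the `Z` basis,
obtaining `z`; measure each `k ∈ B` in the basis `|α^h_k(z)⟩, |α^h_k(z) + π⟩` with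
`α^h_k(z)` the rounded angle; accept if all outcomes in `B` correspond to `|α^h_k(z)⟩`:
`⊕_z (⊗_{k ∈ B} |α^h_k(z)⟩⟨α^h_k(z)|) ⊗ |z⟩⟨z|`. -/
def WeightedGraph.coverTest (G : WeightedGraph V) (h : ℕ) (B : Finset V) :
    Matrix (V → Fin 2) (V → Fin 2) ℂ :=
  ∑ z : {j : V // j ∉ B} → Fin 2,
    tensorOp fun v : V =>
      if hv : v ∈ B then ketBra (phaseKet (roundAngle h (G.angle B z v)))
      else ketBra (basisKet (z ⟨v, hv⟩))

/-- The test operator `Ω_h(𝒜) = ∑_l P_{l;h} / m`. -/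
def WeightedGraph.testOperator (G : WeightedGraph V) (h : ℕ) {m : ℕ} (A : Fin m → Finset V) :
    Matrix (V → Fin 2) (V → Fin 2) ℂ :=
  (1 / (m : ℂ)) • ∑ l, G.coverTest h (A l)

end Graph

section Sampling

variable {X : Type*} [Fintype X] [DecidableEq X] {N : ℕ}

/-- The operator `Ω^{⊗ N}` on the copies different from `i`, identity on copy `i`. -/
def testAllBut (Ω : Matrix X X ℂ) (i : Fin (N + 1)) :
    Matrix (Fin (N + 1) → X) (Fin (N + 1) → X) ℂ :=
  tensorOp fun c => if c = i then 1 else Ω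

/-- The partial trace over all copies but the `i`-th. -/
def traceAllBut (i : Fin (N + 1)) (M : Matrix (Fin (N + 1) → X) (Fin (N + 1) → X) ℂ) :
    Matrix X X ℂ :=
  Matrix.of fun x y => ∑ w : Fin N → X, M (i.insertNth x w) (i.insertNth y w)

/-- The probability that the joint state `ρ` of `N + 1` copies passes the `N`-random sampling
test of `Ω`: the untested copy `i` is uniformly random, the POVM `{Ω, I - Ω}` is applied to each
of the other copies, and all the outcomes have to correspond to `Ω`. -/
def passProb (Ω : Matrix X X ℂ) (ρ : Matrix (Fin (N + 1) → X) (Fin (N + 1) → X) ℂ) : ℝ :=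
  ∑ i : Fin (N + 1), (1 / ((N : ℝ) + 1)) * (Matrix.trace (testAllBut Ω i * ρ)).re

/-- The state of the remaining copy, conditioned on passing the test. -/
def resultantState (Ω : Matrix X X ℂ) (ρ : Matrix (Fin (N + 1) → X) (Fin (N + 1) → X) ℂ) :
    Matrix X X ℂ :=
  ((1 / passProb Ω ρ : ℝ) : ℂ) •
    ∑ i : Fin (N + 1), (1 / ((N : ℂ) + 1)) • traceAllBut i (testAllBut Ω i * ρ)

/-- The fidelity `⟨ψ|σ|ψ⟩`. -/
def fidelity (ψ : X → ℂ) (σ : Matrix X X ℂ) : ℝ :=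
  (star ψ ⬝ᵥ (σ *ᵥ ψ)).re

/-- "When the `N`-random sampling test of `Ω` is passed, the resultant state `σ` satisfies `S`
with significance level `β`": no joint state of the `N + 1` copies (no i.i.d. assumption) whose
resultant state violates `S` passes the test with probability `β` or more. -/
def GuaranteesWithSignificance (N : ℕ) (Ω : Matrix X X ℂ) (β : ℝ) (S : Matrix X X ℂ → Prop) :
    Prop :=
  ∀ ρ : Matrix (Fin (N + 1) → X) (Fin (N + 1) → X) ℂ, IsDensity ρ →
    β ≤ passProb Ω ρ → S (resultantState Ω ρ)

end Sampling

end

/-! The graph state is `U |+⟩^{⊗ n}` with `U` diagonal (`WeightedGraph.gate`). Once the bits `z`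
outside an independent set `B` are fixed, the phase of `U` is affine in the bits of `B`, with the
angles `α_k(z)` as slopes. Conjugation by `U` therefore turns the test of `B` into one with angles
`δ = α^h - α` (`WeightedGraph.adaptiveTest_eq_conj`), and `|δ/2| ≤ π/(4h)`.

Completeness follows at once: `|+⟩` is accepted in the direction `|δ⟩` with probability `cos²(δ/2)`,
and the outcomes `z` are uniform.

For soundness, put `s = sin (π/(4h))`. The operator `|δ⟩⟨δ| - |+⟩⟨+|` has eigenvalues `± sin(δ/2)`,
so exchanging the factors one by one gives `P_{l;h} ≤ U Π_l U* + |A_l| s`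
(`WeightedGraph.coverTest_le`), where `Π_l` projects onto `|+⟩` on `A_l`. The union bound for the
commuting projections `Π_l` yields `1 - |G⟩⟨G| ≤ m (1 - Ω) + n s` (`one_sub_ketBra_state_le`).

It remains to bound the conditional failure probability of the untested copy. Let `f` be the
probability that all `N + 1` copies would pass and `E` the probability that exactly one would fail.
Then `f + E ≤ 1`, the pass probability is `p = f + E/(N+1)`, and the conditional failure probability
is `E/((N+1)p) ≤ (1-p)/(Np) ≤ (1-β)/(Nβ)` (`re_trace_one_sub_mul_resultantState_le`). -/

/-! ### Tensor products of operators and the Loewner order -/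

section TensorOp

open scoped MatrixOrder

variable {ι X : Type*} [Fintype ι]

theorem tensorOp_mul [DecidableEq ι] [Fintype X] (M M' : ι → Matrix X X ℂ) :
    tensorOp M * tensorOp M' = tensorOp fun i => M i * M' i := by
  ext x y
  simp only [tensorOp, Matrix.mul_apply, Matrix.of_apply, ← Finset.prod_mul_distrib,
    Fintype.prod_sum]

theorem tensorOp_one [DecidableEq ι] [DecidableEq X] :
    tensorOp (fun _ : ι => (1 : Matrix X X ℂ)) = 1 := by
  ext x y
  by_cases hxy : x = y
  · subst hxy
    simp [tensorOp, Matrix.one_apply_eq]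
  · obtain ⟨i, hi⟩ := Function.ne_iff.mp hxy
    simp only [tensorOp, Matrix.of_apply, Matrix.one_apply_ne hxy]
    exact Finset.prod_eq_zero (Finset.mem_univ i) (Matrix.one_apply_ne hi)

theorem conjTranspose_tensorOp (M : ι → Matrix X X ℂ) :
    (tensorOp M)ᴴ = tensorOp fun i => (M i)ᴴ := by
  ext x y
  simp [tensorOp, Matrix.conjTranspose_apply]

theorem trace_tensorOp [DecidableEq ι] [Fintype X] (M : ι → Matrix X X ℂ) :
    (tensorOp M).trace = ∏ i, (M i).trace := by
  simp only [Matrix.trace, tensorOp, Matrix.diag_apply, Matrix.of_apply, Fintype.prod_sum]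

/-- Square roots tensor: if each factor is `Bᵢᴴ * Bᵢ`, the product is `Bᴴ * B` with `B = ⊗ᵢ Bᵢ`. -/
theorem tensorOp_nonneg [DecidableEq ι] [Fintype X] [DecidableEq X] {M : ι → Matrix X X ℂ}
    (hM : ∀ i, 0 ≤ M i) : 0 ≤ tensorOp M := by
  have h : ∀ i, ∃ B : Matrix X X ℂ, M i = Bᴴ * B := fun i => by
    obtain ⟨B, hB⟩ := CStarAlgebra.nonneg_iff_eq_star_mul_self.mp (hM i)
    exact ⟨B, hB⟩
  choose B hB using h
  have e : tensorOp M = (tensorOp B)ᴴ * tensorOp B := by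
    rw [conjTranspose_tensorOp, tensorOp_mul]
    congr 1
    funext i
    exact hB i
  rw [e]
  exact (Matrix.posSemidef_conjTranspose_mul_self _).nonneg

theorem tensorOp_add [DecidableEq ι] (M D : ι → Matrix X X ℂ) :
    tensorOp (fun i => M i + D i) = ∑ S : Finset ι, tensorOp (S.piecewise M D) := by
  ext x y
  simp only [tensorOp, Matrix.of_apply, Matrix.add_apply, Fintype.prod_add, Matrix.sum_apply]
  refine Finset.sum_congr rfl fun S _ => ?_
  rw [← Finset.prod_mul_prod_compl S fun i => S.piecewise M D i (x i) (y i)]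
  congr 1
  · exact Finset.prod_congr rfl fun i hi => by rw [Finset.piecewise_eq_of_mem _ _ _ hi]
  · exact Finset.prod_congr rfl fun i hi => by
      rw [Finset.piecewise_eq_of_notMem _ _ _ (Finset.mem_compl.mp hi)]

/-- Expanding `⊗ (M + (M' - M))` gives a sum of nonnegative terms, one of which is `⊗ M`. -/
theorem tensorOp_mono [DecidableEq ι] [Fintype X] [DecidableEq X] {M M' : ι → Matrix X X ℂ}
    (hM : ∀ i, 0 ≤ M i) (h : ∀ i, M i ≤ M' i) : tensorOp M ≤ tensorOp M' := by
  have e : tensorOp M' = ∑ S : Finset ι, tensorOp (S.piecewise M fun i => M' i - M i) := by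
    rw [← tensorOp_add]
    simp
  have h0 : ∀ S : Finset ι, 0 ≤ tensorOp (S.piecewise M fun i => M' i - M i) := fun S =>
    tensorOp_nonneg fun i => by
      by_cases hi : i ∈ S
      · simpa [hi] using hM i
      · simpa [hi] using h i
  calc tensorOp M = tensorOp ((Finset.univ : Finset ι).piecewise M fun i => M' i - M i) := by
        rw [Finset.piecewise_univ]
    _ ≤ _ := by
        rw [e]
        exact Finset.single_le_sum (f := fun S : Finset ι =>
          tensorOp (S.piecewise M fun i => M' i - M i)) (fun S _ => h0 S) (Finset.mem_univ _)

theorem tensorOp_update_apply [DecidableEq ι] (M : ι → Matrix X X ℂ) (k : ι) (R : Matrix X X ℂ)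
    (x y : ι → X) : tensorOp (Function.update M k R) x y =
      R (x k) (y k) * ∏ i ∈ Finset.univ.erase k, M i (x i) (y i) := by
  simp only [tensorOp, Matrix.of_apply]
  rw [← Finset.mul_prod_erase Finset.univ _ (Finset.mem_univ k), Function.update_self]
  congr 1
  exact Finset.prod_congr rfl fun i hi => by
    rw [Function.update_of_ne (Finset.ne_of_mem_erase hi)]

theorem tensorOp_update_sub [DecidableEq ι] (M : ι → Matrix X X ℂ) (k : ι) (P Q : Matrix X X ℂ) :
    tensorOp (Function.update M k (P - Q)) =
      tensorOp (Function.update M k P) - tensorOp (Function.update M k Q) := by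
  ext x y
  simp only [Matrix.sub_apply, tensorOp_update_apply, sub_mul]

theorem tensorOp_update_smul [DecidableEq ι] (M : ι → Matrix X X ℂ) (k : ι) (c : ℂ)
    (P : Matrix X X ℂ) :
    tensorOp (Function.update M k (c • P)) = c • tensorOp (Function.update M k P) := by
  ext x y
  simp only [Matrix.smul_apply, tensorOp_update_apply, smul_eq_mul, mul_assoc]

/-- Changing each tensor factor in `S` by at most `s` changes the tensor product by at most
`|S| s`. -/
theorem tensorOp_piecewise_le [DecidableEq ι] [Fintype X] [DecidableEq X]
    {B : Finset ι} {a b : ι → Matrix X X ℂ} {s : ℝ} (hs : 0 ≤ s)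
    (ha0 : ∀ i, 0 ≤ a i) (hb0 : ∀ i, 0 ≤ b i) (ha1 : ∀ i ∈ B, a i ≤ 1) (hb1 : ∀ i ∈ B, b i ≤ 1)
    (hab : ∀ i ∈ B, a i - b i ≤ (s : ℂ) • 1) {S : Finset ι} (hS : S ⊆ B) :
    tensorOp (S.piecewise a b) ≤
      tensorOp b + ((S.card * s : ℝ) : ℂ) • tensorOp (B.piecewise 1 b) := by
  induction S using Finset.induction_on with
  | empty => simp
  | insert k S hk ih =>
    have hkB : k ∈ B := hS (Finset.mem_insert_self k S)
    have ih := ih ((Finset.subset_insert k S).trans hS)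
    have hpw0 : ∀ i, 0 ≤ S.piecewise a b i := fun i => by
      by_cases hi : i ∈ S <;> simp [hi, ha0, hb0]
    -- Hybrid argument: only factor `k` changes from `b k` to `a k`. The slack `s - (a k - b k)` is
    -- nonnegative, and the product is linear in that factor.
    have hup1 : 0 ≤ tensorOp (Function.update (S.piecewise a b) k ((s : ℂ) • 1 - (a k - b k))) :=
      tensorOp_nonneg fun i => by
        by_cases hi : i = k
        · subst hi
          simpa using hab i hkB
        · simpa [hi] using hpw0 i
    rw [tensorOp_update_sub, tensorOp_update_sub, tensorOp_update_smul,
      ← Finset.piecewise_insert] at hup1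
    have hself : Function.update (S.piecewise a b) k (b k) = S.piecewise a b := by
      conv_rhs => rw [← Function.update_eq_self k (S.piecewise a b)]
      simp [hk]
    rw [hself] at hup1
    -- Enlarging the other factors in `B` to `1` makes the error term the same at every exchange, so
    -- the errors just add up.
    have hmono : tensorOp (Function.update (S.piecewise a b) k 1) ≤ tensorOp (B.piecewise 1 b) := by
      refine tensorOp_mono (fun i => ?_) fun i => ?_
      · by_cases hi : i = k
        · subst hi; simp
        · simpa [hi] using hpw0 i
      · by_cases hi : i = k
        · subst hi; simp [hkB]
        · by_cases hiS : i ∈ S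
          · have hiB : i ∈ B := hS (Finset.mem_insert_of_mem hiS)
            simpa [hi, hiS, hiB] using ha1 i hiB
          · by_cases hiB : i ∈ B
            · simpa [hi, hiS, hiB] using hb1 i hiB
            · simp [hi, hiS, hiB]
    have hsm := smul_le_smul_of_nonneg_left hmono
      (show (0 : ℂ) ≤ (s : ℂ) from Complex.zero_le_real.mpr hs)
    have e : (((insert k S).card * s : ℝ) : ℂ) = ((S.card * s : ℝ) : ℂ) + (s : ℂ) := by
      rw [Finset.card_insert_of_notMem hk]
      push_cast
      ring
    rw [e, add_smul, ← add_assoc]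
    have h2 : tensorOp ((insert k S).piecewise a b) ≤ tensorOp (S.piecewise a b) +
        (s : ℂ) • tensorOp (Function.update (S.piecewise a b) k 1) := by
      rw [← sub_nonneg]
      convert hup1 using 1
      abel
    exact h2.trans (add_le_add ih hsm)

end TensorOp

/-! ### Positivity of traces -/

section Trace

open scoped MatrixOrder

variable {X : Type*} [Fintype X] [DecidableEq X]

/-- With `M = Bᴴ * B`, cyclicity turns the trace into that of `B * R * Bᴴ`. -/
theorem trace_mul_nonneg {M R : Matrix X X ℂ} (hM : 0 ≤ M) (hR : 0 ≤ R) :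
    0 ≤ (M * R).trace := by
  obtain ⟨B, hB⟩ := CStarAlgebra.nonneg_iff_eq_star_mul_self.mp hM
  rw [hB, mul_assoc, Matrix.trace_mul_comm, mul_assoc]
  have h := (hR.posSemidef.mul_mul_conjTranspose_same B).trace_nonneg
  rwa [Matrix.mul_assoc] at h

theorem re_trace_mul_mono {M M' R : Matrix X X ℂ} (hM : M ≤ M') (hR : 0 ≤ R) :
    (M * R).trace.re ≤ (M' * R).trace.re := by
  have h := trace_mul_nonneg (sub_nonneg.mpr hM) hR
  rw [sub_mul, Matrix.trace_sub, sub_nonneg] at h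
  exact (Complex.le_def.mp h).1

omit [DecidableEq X] in
theorem fidelity_eq_re_trace (ψ : X → ℂ) (σ : Matrix X X ℂ) :
    fidelity ψ σ = (ketBra ψ * σ).trace.re := by
  rw [fidelity, ketBra, Matrix.trace_mul_comm, Matrix.mul_vecMulVec, Matrix.trace_vecMulVec,
    dotProduct_comm]

omit [DecidableEq X] in
theorem ketBra_nonneg (ψ : X → ℂ) : 0 ≤ ketBra ψ :=
  (Matrix.posSemidef_vecMulVec_self_star ψ).nonneg

end Trace

/-! ### Random sampling without the i.i.d. assumption -/

section RandomSampling

open scoped MatrixOrder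

variable {X : Type*} [Fintype X] [DecidableEq X] {N : ℕ}

/-- Pairing with a partial trace. -/
theorem trace_mul_traceAllBut (i : Fin (N + 1)) (M : Matrix X X ℂ)
    (R : Matrix (Fin (N + 1) → X) (Fin (N + 1) → X) ℂ) :
    (M * traceAllBut i R).trace =
      (tensorOp (Function.update (fun _ => (1 : Matrix X X ℂ)) i M) * R).trace := by
  have h : ∀ (x y : X) (w v : Fin N → X),
      tensorOp (Function.update (fun _ => (1 : Matrix X X ℂ)) i M) (i.insertNth x w)
        (i.insertNth y v) = M x y * (1 : Matrix (Fin N → X) (Fin N → X) ℂ) w v := by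
    intro x y w v
    rw [← tensorOp_one]
    simp only [tensorOp, Matrix.of_apply]
    rw [Fin.prod_univ_succAbove _ i, Function.update_self, Fin.insertNth_apply_same,
      Fin.insertNth_apply_same]
    congr 1
    refine Finset.prod_congr rfl fun c _ => ?_
    rw [Function.update_of_ne (Fin.succAbove_ne i c), Fin.insertNth_apply_succAbove,
      Fin.insertNth_apply_succAbove]
  have hsum : ∀ f : (Fin (N + 1) → X) → ℂ,
      ∑ q, f q = ∑ x : X, ∑ w : Fin N → X, f (i.insertNth x w) := fun f => by
    rw [← Equiv.sum_comp (Fin.insertNthEquiv (fun _ => X) i) f, Fintype.sum_prod_type]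
    rfl
  simp only [Matrix.trace, Matrix.diag_apply, Matrix.mul_apply, hsum, h, traceAllBut,
    Matrix.of_apply, Matrix.one_apply]
  refine Finset.sum_congr rfl fun x _ => ?_
  rw [Finset.sum_comm]
  simp [Finset.mul_sum]

/-- The operator `M` on copy `i` and `Ω` on all the others. -/
def probeOn (Ω : Matrix X X ℂ) (i : Fin (N + 1)) (M : Matrix X X ℂ) :
    Matrix (Fin (N + 1) → X) (Fin (N + 1) → X) ℂ :=
  tensorOp (Function.update (fun _ => Ω) i M)

omit [Fintype X] in
theorem probeOn_one (Ω : Matrix X X ℂ) (i : Fin (N + 1)) : probeOn Ω i 1 = testAllBut Ω i := by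
  rw [probeOn, testAllBut]
  congr 1
  funext c
  by_cases hc : c = i
  · subst hc; simp
  · simp [hc]

theorem update_mul_testAllBut (Ω : Matrix X X ℂ) (i : Fin (N + 1)) (M : Matrix X X ℂ) :
    tensorOp (Function.update (fun _ => (1 : Matrix X X ℂ)) i M) * testAllBut Ω i =
      probeOn Ω i M := by
  rw [testAllBut, tensorOp_mul, probeOn]
  congr 1
  funext c
  by_cases hc : c = i
  · subst hc; simp
  · simp [hc]

theorem probeOn_mono {Ω M M' : Matrix X X ℂ} (hΩ : 0 ≤ Ω) (hM : M ≤ M') (i : Fin (N + 1)) :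
    probeOn Ω i M ≤ probeOn Ω i M' := by
  rw [← sub_nonneg, probeOn, probeOn, ← tensorOp_update_sub]
  refine tensorOp_nonneg fun c => ?_
  by_cases hc : c = i
  · subst hc; simpa using hM
  · simpa [hc] using hΩ

omit [Fintype X] in
-- A fictitious test of the untested copy, `1 = Ω + (1 - Ω)`, splits the passing event into "all
-- would pass" and "only `i` would fail".
theorem testAllBut_eq_add (Ω : Matrix X X ℂ) (i : Fin (N + 1)) :
    testAllBut Ω i = tensorOp (fun _ => Ω) + probeOn Ω i (1 - Ω) := by
  rw [← probeOn_one, probeOn, probeOn, tensorOp_update_sub,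
    Function.update_eq_self i (fun _ => Ω)]
  abel

/-- At most one of the events "all copies pass" and "exactly copy `i` fails" occurs. -/
theorem tensorOp_add_sum_probeOn_le_one {Ω : Matrix X X ℂ} (h0 : 0 ≤ Ω) (h1 : Ω ≤ 1) :
    tensorOp (fun _ : Fin (N + 1) => Ω) + ∑ i : Fin (N + 1), probeOn Ω i (1 - Ω) ≤ 1 := by
  set T : Finset (Fin (N + 1)) → Matrix (Fin (N + 1) → X) (Fin (N + 1) → X) ℂ :=
    fun S => tensorOp (S.piecewise (fun _ => 1 - Ω) fun _ => Ω) with hT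
  -- Expand `1 = ⊗ ((1 - Ω) + Ω)` over the set `S` of failing copies. All terms are nonnegative;
  -- only `∅` and the singletons are kept.
  have e : (1 : Matrix (Fin (N + 1) → X) (Fin (N + 1) → X) ℂ) = ∑ S, T S := by
    rw [hT, ← tensorOp_add]
    simp [tensorOp_one]
  have hnn : ∀ S, 0 ≤ T S := fun S => tensorOp_nonneg fun i => by
    by_cases hi : i ∈ S
    · simpa [hi] using h1
    · simpa [hi] using h0
  have hs : ∑ i : Fin (N + 1), probeOn Ω i (1 - Ω) =
      ∑ S ∈ Finset.univ.image fun i : Fin (N + 1) => ({i} : Finset (Fin (N + 1))), T S := by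
    rw [Finset.sum_image fun i _ j _ hij => Finset.singleton_injective hij]
    refine Finset.sum_congr rfl fun i _ => ?_
    rw [hT, probeOn]
    simp only [Finset.piecewise_singleton]
  have h0' : tensorOp (fun _ : Fin (N + 1) => Ω) = T ∅ := by simp [hT]
  have hne : (∅ : Finset (Fin (N + 1))) ∉
      Finset.univ.image fun i : Fin (N + 1) => ({i} : Finset (Fin (N + 1))) := by simp
  rw [h0', hs, ← Finset.sum_insert hne, e]
  exact Finset.sum_le_sum_of_subset_of_nonneg (Finset.subset_univ _) fun S _ _ => hnn S

/-- Expectations in the conditioned state become expectations in `ρ` of `M` on one copy and `Ω` on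
the rest. Monotonicity in `M` then comes from `probeOn_mono`, with no need to show that the
resultant state is positive. -/
theorem re_trace_mul_resultantState (Ω M : Matrix X X ℂ)
    (ρ : Matrix (Fin (N + 1) → X) (Fin (N + 1) → X) ℂ) :
    (M * resultantState Ω ρ).trace.re = (1 / passProb Ω ρ) *
      ∑ i : Fin (N + 1), (1 / ((N : ℝ) + 1)) * (probeOn Ω i M * ρ).trace.re := by
  have hN : (1 / ((N : ℂ) + 1)) = ((1 / ((N : ℝ) + 1) : ℝ) : ℂ) := by push_cast; rfl
  rw [resultantState, hN, Matrix.mul_smul, Matrix.trace_smul, smul_eq_mul, Complex.re_ofReal_mul,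
    Finset.mul_sum, Matrix.trace_sum, Complex.re_sum]
  congr 1
  refine Finset.sum_congr rfl fun i _ => ?_
  rw [Matrix.mul_smul, Matrix.trace_smul, smul_eq_mul, Complex.re_ofReal_mul,
    trace_mul_traceAllBut, ← mul_assoc, update_mul_testAllBut]

theorem passProb_eq_sum_probeOn (Ω : Matrix X X ℂ)
    (ρ : Matrix (Fin (N + 1) → X) (Fin (N + 1) → X) ℂ) :
    passProb Ω ρ = ∑ i : Fin (N + 1), (1 / ((N : ℝ) + 1)) * (probeOn Ω i 1 * ρ).trace.re := by
  simp only [passProb, probeOn_one]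

/-- If the random sampling test passes with probability at least `β`, then the remaining copy
fails the test with small conditional probability. -/
theorem re_trace_one_sub_mul_resultantState_le {Ω : Matrix X X ℂ} (h0 : 0 ≤ Ω) (h1 : Ω ≤ 1)
    (hN : 0 < N) {β : ℝ} (hβ : 0 < β) {ρ : Matrix (Fin (N + 1) → X) (Fin (N + 1) → X) ℂ}
    (hρ : IsDensity ρ) (hp : β ≤ passProb Ω ρ) :
    ((1 - Ω) * resultantState Ω ρ).trace.re ≤ (1 - β) / (β * N) := by
  have hNR : (0 : ℝ) < N := by exact_mod_cast hN
  set f := (tensorOp (fun _ : Fin (N + 1) => Ω) * ρ).trace.re with hf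
  set E := ∑ i : Fin (N + 1), (probeOn Ω i (1 - Ω) * ρ).trace.re with hE
  have hfE : f + E ≤ 1 := by
    have h := re_trace_mul_mono (tensorOp_add_sum_probeOn_le_one (N := N) h0 h1) hρ.1.nonneg
    rw [add_mul, Matrix.trace_add, Complex.add_re, Finset.sum_mul, Matrix.trace_sum,
      Complex.re_sum, one_mul, hρ.2] at h
    simpa using h
  have hP : passProb Ω ρ = f + E / (N + 1) := by
    have h : ∀ i : Fin (N + 1), (1 / ((N : ℝ) + 1)) * (testAllBut Ω i * ρ).trace.re =
        (1 / ((N : ℝ) + 1)) * f +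
          (1 / ((N : ℝ) + 1)) * (probeOn Ω i (1 - Ω) * ρ).trace.re := fun i => by
      rw [testAllBut_eq_add, add_mul, Matrix.trace_add, Complex.add_re, mul_add]
    simp only [passProb, h]
    rw [Finset.sum_add_distrib, ← Finset.mul_sum, ← Finset.mul_sum, ← hE,
      Finset.sum_const, Finset.card_univ, Fintype.card_fin, nsmul_eq_mul]
    push_cast
    field_simp
  have hPpos : 0 < passProb Ω ρ := hβ.trans_le hp
  rw [re_trace_mul_resultantState, ← Finset.mul_sum, ← hE]
  -- Subtracting `p = f + E/(N+1)` from `f + E ≤ 1` leaves `N E/(N+1) ≤ 1 - p`.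
  have h2 : E / (N + 1) ≤ (1 - passProb Ω ρ) / N := by
    rw [le_div_iff₀ hNR]
    have : E / (N + 1) * N = E - E / (N + 1) := by field_simp; ring
    rw [this]
    linarith
  calc 1 / passProb Ω ρ * (1 / ((N : ℝ) + 1) * E) = E / (N + 1) / passProb Ω ρ := by ring
    _ ≤ (1 - passProb Ω ρ) / N / passProb Ω ρ := by gcongr
    _ = (1 / passProb Ω ρ - 1) / N := by field_simp
    -- The bound decreases in the pass probability, so the worst case is `β`.
    _ ≤ (1 / β - 1) / N := by gcongr
    _ = (1 - β) / (β * N) := by field_simp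

/-- An operator inequality `1 - |ψ⟩⟨ψ| ≤ c (1 - Ω) + ε` turns into a fidelity bound. -/
theorem fidelity_resultantState_ge {Ω : Matrix X X ℂ} (h0 : 0 ≤ Ω) (h1 : Ω ≤ 1)
    (hN : 0 < N) {β : ℝ} (hβ : 0 < β) {ρ : Matrix (Fin (N + 1) → X) (Fin (N + 1) → X) ℂ}
    (hρ : IsDensity ρ) (hp : β ≤ passProb Ω ρ) {ψ : X → ℂ} {c ε : ℝ} (hc : 0 ≤ c)
    (hψ : 1 - ketBra ψ ≤ (c : ℂ) • (1 - Ω) + (ε : ℂ) • 1) :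
    1 - (c * (1 - β) / (β * N) + ε) ≤ fidelity ψ (resultantState Ω ρ) := by
  have hPpos : 0 < passProb Ω ρ := hβ.trans_le hp
  -- Normalisation: the weight of `M = 1` is the pass probability itself.
  have hone : ((1 : Matrix X X ℂ) * resultantState Ω ρ).trace.re = 1 := by
    rw [re_trace_mul_resultantState, ← passProb_eq_sum_probeOn, one_div_mul_cancel hPpos.ne']
  have hmono : ((1 - ketBra ψ) * resultantState Ω ρ).trace.re ≤
      (((c : ℂ) • (1 - Ω) + (ε : ℂ) • 1) * resultantState Ω ρ).trace.re := by
    rw [re_trace_mul_resultantState, re_trace_mul_resultantState]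
    refine mul_le_mul_of_nonneg_left (Finset.sum_le_sum fun i _ => ?_) (by positivity)
    exact mul_le_mul_of_nonneg_left
      (re_trace_mul_mono (probeOn_mono h0 hψ i) hρ.1.nonneg) (by positivity)
  have hmain := re_trace_one_sub_mul_resultantState_le h0 h1 hN hβ hρ hp
  rw [add_mul, Matrix.trace_add, Complex.add_re, Matrix.smul_mul, Matrix.smul_mul,
    Matrix.trace_smul, Matrix.trace_smul, smul_eq_mul, smul_eq_mul, Complex.re_ofReal_mul,
    Complex.re_ofReal_mul, hone, sub_mul, Matrix.trace_sub, Complex.sub_re, hone,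
    ← fidelity_eq_re_trace] at hmono
  have h3 := mul_le_mul_of_nonneg_left hmain hc
  rw [← mul_div_assoc] at h3
  linarith

/-- The passing probability of independent copies of a pure state. -/
theorem passProb_tensorOp_ketBra (Ω : Matrix X X ℂ) {ψ : X → ℂ} (hψ : (ketBra ψ).trace = 1)
    {t : ℝ} (ht : (Ω * ketBra ψ).trace = t) :
    passProb Ω (tensorOp fun _ : Fin (N + 1) => ketBra ψ) = t ^ N := by
  have h : ∀ i : Fin (N + 1),
      (testAllBut Ω i * tensorOp fun _ : Fin (N + 1) => ketBra ψ).trace.re = t ^ N := fun i => by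
    rw [testAllBut, tensorOp_mul, trace_tensorOp, Fin.prod_univ_succAbove _ i]
    simp only [if_true, one_mul, hψ, Fin.succAbove_ne, if_false, ht, Finset.prod_const,
      Finset.card_univ, Fintype.card_fin]
    rw [← Complex.ofReal_pow, Complex.ofReal_re]
  simp only [passProb, h, Finset.sum_const, Finset.card_univ, Fintype.card_fin, nsmul_eq_mul]
  push_cast
  field_simp

end RandomSampling

/-! ### Single-qubit estimates -/

section Qubit

open scoped MatrixOrder

theorem ketBra_basisKet_apply (a p q : Fin 2) :
    ketBra (basisKet a) p q = if p = a ∧ q = a then 1 else 0 := by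
  fin_cases a <;> fin_cases p <;> fin_cases q <;>
    simp [ketBra, basisKet, Matrix.vecMulVec_apply]

/-- Each entry is `1/2` times a phase linear in `α`, so products of entries and conjugation by a
diagonal unitary reduce to adding exponents. -/
theorem ketBra_phaseKet_apply (α : ℝ) (p q : Fin 2) :
    ketBra (phaseKet α) p q =
      1 / 2 * Complex.exp (Complex.I * ((((p : ℕ) : ℝ) - ((q : ℕ) : ℝ)) * α : ℝ)) := by
  have h2 : (1 / (Real.sqrt 2 : ℂ)) * (1 / (Real.sqrt 2 : ℂ)) = 1 / 2 := by
    rw [div_mul_div_comm, ← Complex.ofReal_mul, Real.mul_self_sqrt (by norm_num)]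
    norm_num
  have hs : star (Complex.exp (Complex.I * (α : ℂ))) = Complex.exp (-(Complex.I * (α : ℂ))) := by
    rw [Complex.star_def, ← Complex.exp_conj]
    simp
  have hr : star (1 / (Real.sqrt 2 : ℂ)) = 1 / (Real.sqrt 2 : ℂ) := by
    simp
  have h : ketBra (phaseKet α) p q = (1 / 2) *
      ((basisKet 0 p + Complex.exp (Complex.I * (α : ℂ)) * basisKet 1 p) *
        star (basisKet 0 q + Complex.exp (Complex.I * (α : ℂ)) * basisKet 1 q)) := by
    rw [← h2, ketBra, Matrix.vecMulVec_apply, Pi.star_apply]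
    simp only [phaseKet]
    rw [star_mul', hr]
    ring
  rw [h, star_add, star_mul', hs]
  congr 1
  fin_cases p <;> fin_cases q <;> simp [basisKet, ← Complex.exp_add]

theorem plusKet_eq_phaseKet : plusKet = phaseKet 0 := by
  funext a
  simp [plusKet, phaseKet]

theorem trace_ketBra_phaseKet (α : ℝ) : (ketBra (phaseKet α)).trace = 1 := by
  simp only [Matrix.trace, Matrix.diag_apply, Fin.sum_univ_two, ketBra_phaseKet_apply, sub_self]
  norm_num

theorem trace_ketBra_basisKet_mul_plusKet (a : Fin 2) :
    (ketBra (basisKet a) * ketBra plusKet).trace = ((1 / 2 : ℝ) : ℂ) := by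
  rw [plusKet_eq_phaseKet]
  simp only [Matrix.trace, Matrix.diag_apply, Fin.sum_univ_two, Matrix.mul_apply,
    ketBra_phaseKet_apply, ketBra_basisKet_apply]
  fin_cases a <;> simp

theorem trace_ketBra_phaseKet_mul_plusKet (δ : ℝ) :
    (ketBra (phaseKet δ) * ketBra plusKet).trace = ((Real.cos (δ / 2) ^ 2 : ℝ) : ℂ) := by
  rw [plusKet_eq_phaseKet]
  simp only [Matrix.trace, Matrix.diag_apply, Fin.sum_univ_two, Matrix.mul_apply,
    ketBra_phaseKet_apply]
  have h : Real.cos (δ / 2) ^ 2 = 1 / 2 + Real.cos δ / 2 := by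
    rw [Real.cos_sq]
    ring_nf
  rw [h]
  push_cast
  rw [Complex.cos]
  simp
  ring_nf

theorem IsStarProjection.ketBra_of_trace {X : Type*} [Fintype X] {ψ : X → ℂ}
    (h : (ketBra ψ).trace = 1) : IsStarProjection (ketBra ψ) where
  isIdempotentElem := by
    rw [ketBra, Matrix.trace_vecMulVec] at h
    rw [IsIdempotentElem, ketBra, Matrix.vecMulVec_mul_vecMulVec, dotProduct_comm, h]
    simp
  isSelfAdjoint := (ketBra_nonneg ψ).posSemidef.isHermitian

theorem isStarProjection_ketBra_phaseKet (α : ℝ) : IsStarProjection (ketBra (phaseKet α)) :=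
  IsStarProjection.ketBra_of_trace (trace_ketBra_phaseKet α)

/-- The quadratic form at `x` is at least `s (‖x 0‖ - ‖x 1‖)²`. -/
theorem nonneg_of_offDiag_norm_le {M : Matrix (Fin 2) (Fin 2) ℂ} {s : ℝ}
    (h0 : M 0 0 = s) (h1 : M 1 1 = s) (h2 : M 1 0 = star (M 0 1)) (h3 : ‖M 0 1‖ ≤ s) : 0 ≤ M := by
  refine (Matrix.PosSemidef.of_dotProduct_mulVec_nonneg ?_ fun x => ?_).nonneg
  · ext p q
    fin_cases p <;> fin_cases q <;> simp [Matrix.conjTranspose_apply, h0, h1, h2]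
  · have e : star x ⬝ᵥ (M *ᵥ x) =
        ((s * (‖x 0‖ ^ 2 + ‖x 1‖ ^ 2) + 2 * (star (x 0) * M 0 1 * x 1).re : ℝ) : ℂ) := by
      have a0 : star (x 0) * x 0 = ((‖x 0‖ ^ 2 : ℝ) : ℂ) := by
        rw [mul_comm, Complex.star_def, Complex.mul_conj, Complex.normSq_eq_norm_sq]
      have a1 : star (x 1) * x 1 = ((‖x 1‖ ^ 2 : ℝ) : ℂ) := by
        rw [mul_comm, Complex.star_def, Complex.mul_conj, Complex.normSq_eq_norm_sq]
      have a2 := Complex.add_conj (star (x 0) * M 0 1 * x 1)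
      have a3 : (starRingEnd ℂ) (star (x 0) * M 0 1 * x 1) = x 0 * star (M 0 1) * star (x 1) := by
        simp
      rw [a3] at a2
      push_cast at a0 a1 a2 ⊢
      rw [← a2, ← a0, ← a1]
      simp only [dotProduct, Matrix.mulVec, Fin.sum_univ_two, Pi.star_apply, h0, h1, h2]
      ring
    rw [e]
    refine Complex.zero_le_real.mpr ?_
    have b1 := Complex.abs_re_le_norm (star (x 0) * M 0 1 * x 1)
    rw [norm_mul, norm_mul, norm_star] at b1
    have b2 := neg_le_of_abs_le b1
    have b3 : ‖x 0‖ * ‖M 0 1‖ * ‖x 1‖ ≤ s * (‖x 0‖ * ‖x 1‖) := by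
      have := mul_le_mul_of_nonneg_left h3 (mul_nonneg (norm_nonneg (x 0)) (norm_nonneg (x 1)))
      nlinarith
    have hs : 0 ≤ s := (norm_nonneg _).trans h3
    nlinarith [mul_nonneg hs (sq_nonneg (‖x 0‖ - ‖x 1‖))]

/-- The difference has zero diagonal and off-diagonal entries of modulus `|e^{iδ} - 1| / 2 =
|sin(δ/2)|`. -/
theorem ketBra_phaseKet_sub_plusKet_le {δ s : ℝ} (h : |Real.sin (δ / 2)| ≤ s) :
    ketBra (phaseKet δ) - ketBra plusKet ≤ (s : ℂ) • 1 := by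
  rw [plusKet_eq_phaseKet, ← sub_nonneg]
  refine nonneg_of_offDiag_norm_le (s := s) ?_ ?_ ?_ ?_
  · simp [ketBra_phaseKet_apply]
  · simp [ketBra_phaseKet_apply]
  · simp [ketBra_phaseKet_apply, ← Complex.exp_conj]
  · have e : ((s : ℂ) • (1 : Matrix (Fin 2) (Fin 2) ℂ) -
        (ketBra (phaseKet δ) - ketBra (phaseKet 0))) 0 1 =
        1 / 2 * -(Complex.exp (Complex.I * ((-δ : ℝ) : ℂ)) - 1) := by
      simp [ketBra_phaseKet_apply]
      ring
    rw [e, norm_mul, norm_neg, Complex.norm_exp_I_mul_ofReal_sub_one]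
    simp only [neg_div, Real.sin_neg, mul_neg, norm_neg, norm_mul, Real.norm_eq_abs]
    norm_num
    linarith

end Qubit

/-! ### Adaptive tests and projections onto `|+⟩` -/

section Tests

open scoped MatrixOrder

variable {V : Type*} [Fintype V] [DecidableEq V]

/-- Measure the qubits outside `B` in the computational basis, obtaining `z`, and apply the
product test `⊗_{v ∈ B} a z v` to the others. -/
def adaptiveTest (B : Finset V)
    (a : ({j : V // j ∉ B} → Fin 2) → V → Matrix (Fin 2) (Fin 2) ℂ) :
    Matrix (V → Fin 2) (V → Fin 2) ℂ :=
  ∑ z : {j : V // j ∉ B} → Fin 2,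
    tensorOp fun v : V => if hv : v ∈ B then a z v else ketBra (basisKet (z ⟨v, hv⟩))

/-- The basis projections outside `B` annihilate every `z` except the restriction of `x`, so the sum
collapses. Together with the next lemma: an adaptive test is block diagonal, with blocks indexed by
the bits outside `B`. -/
theorem adaptiveTest_apply_of_agree (B : Finset V)
    (a : ({j : V // j ∉ B} → Fin 2) → V → Matrix (Fin 2) (Fin 2) ℂ) {x y : V → Fin 2}
    (h : ∀ v ∉ B, x v = y v) :
    adaptiveTest B a x y = ∏ v ∈ B, a (fun j => x j.1) v (x v) (y v) := by
  rw [adaptiveTest, Matrix.sum_apply, Fintype.sum_eq_single fun j : {j : V // j ∉ B} => x j.1]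
  · simp only [tensorOp, Matrix.of_apply]
    rw [← Finset.prod_subset (Finset.subset_univ B)]
    · exact Finset.prod_congr rfl fun v hv => by rw [dif_pos hv]
    · intro v _ hv
      rw [dif_neg hv, ketBra_basisKet_apply, if_pos ⟨rfl, (h v hv).symm⟩]
  · intro z hz
    obtain ⟨⟨v, hv⟩, hzv⟩ := Function.ne_iff.mp hz
    simp only [tensorOp, Matrix.of_apply]
    refine Finset.prod_eq_zero (Finset.mem_univ v) ?_
    rw [dif_neg hv, ketBra_basisKet_apply, if_neg fun hc => hzv hc.1.symm]

theorem adaptiveTest_apply_of_disagree (B : Finset V)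
    (a : ({j : V // j ∉ B} → Fin 2) → V → Matrix (Fin 2) (Fin 2) ℂ) {x y : V → Fin 2}
    {v : V} (hv : v ∉ B) (h : x v ≠ y v) :
    adaptiveTest B a x y = 0 := by
  rw [adaptiveTest, Matrix.sum_apply]
  refine Finset.sum_eq_zero fun z _ => ?_
  simp only [tensorOp, Matrix.of_apply]
  refine Finset.prod_eq_zero (Finset.mem_univ v) ?_
  rw [dif_neg hv, ketBra_basisKet_apply, if_neg fun hc => h (hc.1.trans hc.2.symm)]

/-- A test that ignores the outcomes outside `B` does not need the measurement there. -/
theorem adaptiveTest_const (B : Finset V) (a : V → Matrix (Fin 2) (Fin 2) ℂ) :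
    adaptiveTest B (fun _ => a) = tensorOp fun v => if v ∈ B then a v else 1 := by
  ext x y
  by_cases h : ∀ v ∉ B, x v = y v
  · rw [adaptiveTest_apply_of_agree B _ h]
    simp only [tensorOp, Matrix.of_apply]
    rw [← Finset.prod_subset (Finset.subset_univ B)]
    · exact Finset.prod_congr rfl fun v hv => by rw [if_pos hv]
    · intro v _ hv
      rw [if_neg hv, h v hv, Matrix.one_apply_eq]
  · push Not at h
    obtain ⟨v, hv, hne⟩ := h
    rw [adaptiveTest_apply_of_disagree B _ hv hne]
    simp only [tensorOp, Matrix.of_apply]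
    exact (Finset.prod_eq_zero (Finset.mem_univ v) (by
      rw [if_neg hv, Matrix.one_apply_ne hne])).symm

/-- Writing the identity as an adaptive test lets bounds involving `1` be checked separately for
each `z`. -/
theorem adaptiveTest_one (B : Finset V) : adaptiveTest B (fun _ _ => 1) = 1 := by
  rw [adaptiveTest_const]
  simp [tensorOp_one]

theorem adaptiveTest_nonneg (B : Finset V)
    {a : ({j : V // j ∉ B} → Fin 2) → V → Matrix (Fin 2) (Fin 2) ℂ} (ha : ∀ z v, 0 ≤ a z v) :
    0 ≤ adaptiveTest B a :=
  Finset.sum_nonneg fun z _ => tensorOp_nonneg fun v => by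
    split_ifs
    · exact ha z v
    · exact ketBra_nonneg _

theorem adaptiveTest_le_one (B : Finset V)
    {a : ({j : V // j ∉ B} → Fin 2) → V → Matrix (Fin 2) (Fin 2) ℂ} (ha : ∀ z v, 0 ≤ a z v)
    (ha1 : ∀ z v, a z v ≤ 1) : adaptiveTest B a ≤ 1 := by
  rw [← adaptiveTest_one B]
  refine Finset.sum_le_sum fun z _ => tensorOp_mono (fun v => ?_) fun v => ?_
  · split_ifs
    · exact ha z v
    · exact ketBra_nonneg _
  · split_ifs
    · exact ha1 z v
    · exact le_rfl

/-- Perturbing each factor of an adaptive test by at most `s` perturbs the test by at most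
`|B| s`. -/
theorem adaptiveTest_le_add (B : Finset V)
    {a b : ({j : V // j ∉ B} → Fin 2) → V → Matrix (Fin 2) (Fin 2) ℂ} {s : ℝ} (hs : 0 ≤ s)
    (ha : ∀ z v, IsStarProjection (a z v)) (hb : ∀ z v, IsStarProjection (b z v))
    (hab : ∀ z v, a z v - b z v ≤ (s : ℂ) • 1) :
    adaptiveTest B a ≤ adaptiveTest B b + ((B.card * s : ℝ) : ℂ) • 1 := by
  rw [← adaptiveTest_one B]
  simp only [adaptiveTest]
  rw [Finset.smul_sum, ← Finset.sum_add_distrib]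
  refine Finset.sum_le_sum fun z _ => ?_
  have key := tensorOp_piecewise_le (B := B) (S := B) hs
    (a := fun v : V => if hv : v ∈ B then a z v else ketBra (basisKet (z ⟨v, hv⟩)))
    (b := fun v : V => if hv : v ∈ B then b z v else ketBra (basisKet (z ⟨v, hv⟩)))
    (fun v => by
      split_ifs
      · exact (ha z v).nonneg
      · exact ketBra_nonneg _)
    (fun v => by
      split_ifs
      · exact (hb z v).nonneg
      · exact ketBra_nonneg _)
    (fun v hv => by simpa [hv] using (ha z v).le_one)
    (fun v hv => by simpa [hv] using (hb z v).le_one)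
    (fun v hv => by simpa [hv] using hab z v) (Finset.Subset.refl B)
  convert key using 2
  · funext v
    by_cases hv : v ∈ B <;> simp [hv]
  · congr 2
    funext v
    by_cases hv : v ∈ B <;> simp [hv]

/-- The projection onto `|+⟩` on all the qubits of `S`. -/
noncomputable def plusProj (S : Finset V) : Matrix (V → Fin 2) (V → Fin 2) ℂ :=
  tensorOp fun v => if v ∈ S then ketBra plusKet else 1

theorem isStarProjection_plusKet : IsStarProjection (ketBra plusKet) := by
  rw [plusKet_eq_phaseKet]
  exact isStarProjection_ketBra_phaseKet 0

theorem plusProj_mul (S T : Finset V) : plusProj S * plusProj T = plusProj (S ∪ T) := by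
  rw [plusProj, plusProj, tensorOp_mul, plusProj]
  congr 1
  funext v
  have h : ketBra plusKet * ketBra plusKet = ketBra plusKet :=
    isStarProjection_plusKet.isIdempotentElem
  by_cases hS : v ∈ S <;> by_cases hT : v ∈ T <;> simp [hS, hT, h]

theorem isStarProjection_plusProj (S : Finset V) : IsStarProjection (plusProj S) where
  isIdempotentElem := by rw [IsIdempotentElem, plusProj_mul, Finset.union_self]
  isSelfAdjoint := by
    refine (tensorOp_nonneg fun v => ?_).posSemidef.isHermitian
    split_ifs
    · exact ketBra_nonneg _
    · exact zero_le_one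

/-- The right side minus the left is `(1 - P) * (1 - Q)` for the commuting projections `P`, `Q` of
`S` and `T`; this product is again a projection. -/
theorem one_sub_plusProj_union_le (S T : Finset V) :
    1 - plusProj (S ∪ T) ≤ (1 - plusProj S) + (1 - plusProj T) := by
  have hS := (isStarProjection_plusProj S).one_sub
  have hT := (isStarProjection_plusProj T).one_sub
  have hc : (1 - plusProj S) * (1 - plusProj T) = (1 - plusProj T) * (1 - plusProj S) := by
    have h : plusProj S * plusProj T = plusProj T * plusProj S := by
      rw [plusProj_mul, plusProj_mul, Finset.union_comm]
    simp only [sub_mul, mul_sub, one_mul, mul_one, h]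
    abel
  have hP : IsStarProjection ((1 - plusProj S) * (1 - plusProj T)) :=
    { isIdempotentElem := hS.isIdempotentElem.mul_of_commute hc hT.isIdempotentElem
      isSelfAdjoint := by
        rw [IsSelfAdjoint, star_mul, hS.isSelfAdjoint.star_eq, hT.isSelfAdjoint.star_eq, hc] }
  rw [← sub_nonneg]
  convert hP.nonneg using 1
  rw [← plusProj_mul, sub_mul, mul_sub, mul_sub, one_mul, mul_one, one_mul]
  abel

/-- Union bound for the tests of `|+⟩` on the members of a family of sets. -/
theorem one_sub_plusProj_biUnion_le {κ : Type*} [DecidableEq κ] (T : Finset κ)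
    (A : κ → Finset V) : 1 - plusProj (T.biUnion A) ≤ ∑ l ∈ T, (1 - plusProj (A l)) := by
  induction T using Finset.induction_on with
  | empty => simp [plusProj, tensorOp_one]
  | insert k T hk ih =>
    rw [Finset.biUnion_insert, Finset.sum_insert hk]
    exact (one_sub_plusProj_union_le _ _).trans (by gcongr)

/-- The adaptive test in bases close to the Hadamard basis accepts `|+⟩^{⊗ n}` with high
probability. -/
theorem trace_adaptiveTest_mul_plus (B : Finset V) (δ : ({j : V // j ∉ B} → Fin 2) → V → ℝ)
    {c : ℝ} (hc0 : 0 ≤ c) (hc : ∀ z, ∀ v ∈ B, c ≤ Real.cos (δ z v / 2) ^ 2) :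
    ∃ t : ℝ, (adaptiveTest B (fun z v => ketBra (phaseKet (δ z v))) *
        tensorOp fun _ => ketBra plusKet).trace = (t : ℂ) ∧ c ^ B.card ≤ t := by
  refine ⟨∑ z : {j : V // j ∉ B} → Fin 2, ∏ v : V,
    if v ∈ B then Real.cos (δ z v / 2) ^ 2 else 1 / 2, ?_, ?_⟩
  · rw [adaptiveTest, Finset.sum_mul, Matrix.trace_sum, Complex.ofReal_sum]
    refine Finset.sum_congr rfl fun z _ => ?_
    rw [tensorOp_mul, trace_tensorOp, Complex.ofReal_prod]
    refine Finset.prod_congr rfl fun v _ => ?_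
    by_cases hv : v ∈ B
    · simp only [hv, dif_pos, if_pos, trace_ketBra_phaseKet_mul_plusKet]
    · rw [dif_neg hv, if_neg hv, trace_ketBra_basisKet_mul_plusKet]
  -- Each outcome `z` has probability `2^{-|Bᶜ|}`, and there are `2^{|Bᶜ|}` of them, so these
  -- factors cancel in the sum.
  · have h : ∀ z : {j : V // j ∉ B} → Fin 2, c ^ B.card * (1 / 2) ^ (Bᶜ).card ≤
        ∏ v : V, if v ∈ B then Real.cos (δ z v / 2) ^ 2 else 1 / 2 := fun z => by
      have e : c ^ B.card * (1 / 2) ^ (Bᶜ).card = ∏ v : V, if v ∈ B then c else 1 / 2 := by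
        rw [Finset.prod_ite, Finset.prod_const, Finset.prod_const]
        congr 3
        · simp
        · ext v; simp
      rw [e]
      refine Finset.prod_le_prod (fun v _ => ?_) fun v _ => ?_
      · split_ifs
        · exact hc0
        · norm_num
      · split_ifs with hv
        · exact hc z v hv
        · exact le_rfl
    refine le_trans (le_of_eq ?_) (Finset.sum_le_sum fun z _ => h z)
    rw [Finset.sum_const, Finset.card_univ, Fintype.card_fun, Fintype.card_fin,
      Fintype.card_subtype, nsmul_eq_mul]
    have e : (Finset.univ.filter fun j => j ∉ B) = Bᶜ := by ext; simp
    rw [e]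
    push_cast
    rw [mul_left_comm, ← mul_pow]
    norm_num

end Tests

/-! ### Weighted graph states, their tests and the spectral gap -/

section GraphState

open scoped MatrixOrder

variable {V : Type*} [Fintype V] [DecidableEq V]

/-- The product `x_j x_k` for an unordered pair `{j, k}`. -/
def pairBit (x : V → Fin 2) (e : Sym2 V) : ℝ :=
  Sym2.lift ⟨fun j k => ((x j : ℕ) : ℝ) * ((x k : ℕ) : ℝ), fun _ _ => mul_comm _ _⟩ e

open Classical in
/-- The phase of the amplitude of `|x⟩` in a weighted graph state. -/
noncomputable def WeightedGraph.phase (G : WeightedGraph V) (x : V → Fin 2) : ℝ :=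
  ∑ e ∈ Finset.univ.filter fun e : Sym2 V => e ∈ G.graph.edgeSet, G.weight e * pairBit x e

/-- The diagonal unitary that prepares the weighted graph state from `|+⟩^{⊗ n}`. -/
noncomputable def WeightedGraph.gate (G : WeightedGraph V) :
    Matrix (V → Fin 2) (V → Fin 2) ℂ :=
  Matrix.diagonal fun x => Complex.exp (Complex.I * (G.phase x : ℂ))

theorem edgeGate_eq_diagonal (θ : ℝ) (e : Sym2 V) :
    edgeGate θ e = Matrix.diagonal fun x : V → Fin 2 =>
      Complex.exp (Complex.I * ((θ * pairBit x e : ℝ) : ℂ)) := by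
  induction e using Sym2.ind with
  | _ j k =>
    simp only [edgeGate, Sym2.lift_mk, controlledPhase_eq_diagonal, pairBit]
    congr 1
    funext x
    have hj : x j = 0 ∨ x j = 1 := by omega
    have hk : x k = 0 ∨ x k = 1 := by omega
    rcases hj with hj | hj <;> rcases hk with hk | hk <;> simp [hj, hk]

theorem WeightedGraph.state_eq (G : WeightedGraph V) :
    G.state = G.gate *ᵥ tensorVec fun _ : V => plusKet := by
  classical
  rw [WeightedGraph.state]
  congr 1
  refine (Finset.noncommProd_congr rfl (fun e _ => edgeGate_eq_diagonal (G.weight e) e) _).trans ?_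
  -- The product of diagonal gates is the image under `Matrix.diagonalRingHom` of a product in the
  -- commutative ring of functions.
  have h := Finset.map_noncommProd (Finset.univ.filter fun e : Sym2 V => e ∈ G.graph.edgeSet)
    (fun e => fun x : V → Fin 2 => Complex.exp (Complex.I * ((G.weight e * pairBit x e : ℝ) : ℂ)))
    (fun _ _ _ _ _ => Commute.all _ _) (Matrix.diagonalRingHom (V → Fin 2) ℂ)
  rw [Finset.noncommProd_eq_prod] at h
  refine h.symm.trans ?_
  rw [WeightedGraph.gate]
  change Matrix.diagonal _ = Matrix.diagonal _
  congr 1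
  funext x
  rw [Finset.prod_apply, ← Complex.exp_sum, WeightedGraph.phase, Complex.ofReal_sum,
    Finset.mul_sum]

omit [DecidableEq V] in
theorem WeightedGraph.conjTranspose_gate_apply (G : WeightedGraph V) :
    G.gateᴴ = Matrix.diagonal fun x => Complex.exp (-(Complex.I * (G.phase x : ℂ))) := by
  rw [WeightedGraph.gate, Matrix.diagonal_conjTranspose]
  congr 1
  funext x
  rw [Pi.star_apply, Complex.star_def, ← Complex.exp_conj]
  simp

theorem WeightedGraph.gate_mul_conjTranspose (G : WeightedGraph V) : G.gate * G.gateᴴ = 1 := by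
  rw [WeightedGraph.conjTranspose_gate_apply, WeightedGraph.gate, Matrix.diagonal_mul_diagonal]
  simp [← Complex.exp_add]

theorem WeightedGraph.conjTranspose_gate_mul (G : WeightedGraph V) : G.gateᴴ * G.gate = 1 := by
  rw [WeightedGraph.conjTranspose_gate_apply, WeightedGraph.gate, Matrix.diagonal_mul_diagonal]
  simp [← Complex.exp_add]

theorem ketBra_tensorVec {ι X : Type*} [Fintype ι] (ψ : ι → X → ℂ) :
    ketBra (tensorVec ψ) = tensorOp fun i => ketBra (ψ i) := by
  ext x y
  simp [ketBra, tensorVec, tensorOp, Matrix.vecMulVec_apply, Finset.prod_mul_distrib]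

theorem WeightedGraph.ketBra_state (G : WeightedGraph V) :
    ketBra G.state = G.gate * plusProj Finset.univ * G.gateᴴ := by
  have h : plusProj (Finset.univ : Finset V) = ketBra (tensorVec fun _ : V => plusKet) := by
    rw [ketBra_tensorVec]
    simp [plusProj]
  rw [h, G.state_eq, ketBra, ketBra, Matrix.mul_vecMulVec, Matrix.vecMulVec_mul,
    Matrix.star_mulVec]

theorem WeightedGraph.trace_ketBra_state (G : WeightedGraph V) : (ketBra G.state).trace = 1 := by
  rw [G.ketBra_state, Matrix.trace_mul_comm, ← mul_assoc, G.conjTranspose_gate_mul, one_mul,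
    plusProj, trace_tensorOp]
  simp [plusKet_eq_phaseKet, trace_ketBra_phaseKet]

/-- On an independent set, changing the basis state changes the phase linearly. -/
theorem WeightedGraph.phase_sub_phase (G : WeightedGraph V) {B : Finset V}
    (hB : G.graph.IsIndepSet (B : Set V)) {x y : V → Fin 2} (h : ∀ v ∉ B, x v = y v) :
    G.phase x - G.phase y =
      ∑ k ∈ B, (((x k : ℕ) : ℝ) - ((y k : ℕ) : ℝ)) * G.angle B (fun j => x j.1) k := by
  classical
  have hind : ∀ k ∈ B, ∀ j ∈ B, ¬ G.graph.Adj j k := fun k hk j hj hadj =>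
    hB hj hk hadj.ne hadj
  -- By independence, each edge meeting `B` has exactly one end `k` in `B` and the other end `j`
  -- outside. So `P` lists these edges without repetition, and `hzero` shows that the remaining
  -- edges have the same phase for `x` and `y`.
  set P : Finset (Σ _ : V, {j : V // j ∉ B}) :=
    B.sigma fun k => Finset.univ.filter fun j : {j : V // j ∉ B} => G.graph.Adj j.1 k with hP
  have hmem : ∀ p, p ∈ P ↔ p.1 ∈ B ∧ G.graph.Adj p.2.1 p.1 := fun p => by simp [hP]
  have hinj : Set.InjOn (fun p : (Σ _ : V, {j : V // j ∉ B}) => s(p.2.1, p.1)) P := by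
    rintro ⟨k, j, hj⟩ hp ⟨k', j', hj'⟩ hp' he
    have hk := ((hmem _).mp hp).1
    have hk' := ((hmem _).mp hp').1
    rcases Sym2.eq_iff.mp he with ⟨h1, h2⟩ | ⟨h1, h2⟩
    · simp only at h1 h2
      subst h1 h2
      rfl
    · simp only at h1 h2 hk'
      exact absurd (h1 ▸ hk') hj
  have hsub : P.image (fun p => s(p.2.1, p.1)) ⊆
      Finset.univ.filter fun e : Sym2 V => e ∈ G.graph.edgeSet := by
    intro e he
    obtain ⟨p, hp, rfl⟩ := Finset.mem_image.mp he
    simpa using ((hmem p).mp hp).2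
  have hzero : ∀ e ∈ Finset.univ.filter fun e : Sym2 V => e ∈ G.graph.edgeSet,
      e ∉ P.image (fun p => s(p.2.1, p.1)) →
      G.weight e * pairBit x e - G.weight e * pairBit y e = 0 := by
    intro e he hne
    induction e using Sym2.ind with
    | _ j k =>
      have hadj : G.graph.Adj j k := by simpa using he
      have key : ∀ a b, s(a, b) = s(j, k) → a ∈ B → False := by
        intro a b hab ha
        have hadj' : G.graph.Adj b a := by
          rw [← SimpleGraph.mem_edgeSet, Sym2.eq_swap, hab]
          exact hadj
        have hb : b ∉ B := fun hb => hind a ha b hb hadj'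
        refine hne (Finset.mem_image.mpr ⟨⟨a, b, hb⟩, (hmem _).mpr ⟨ha, hadj'⟩, ?_⟩)
        rw [← hab]
        exact Sym2.eq_swap
      have hj : j ∉ B := fun hj => key j k rfl hj
      have hk : k ∉ B := fun hk => key k j Sym2.eq_swap hk
      simp only [pairBit, Sym2.lift_mk, h j hj, h k hk, sub_self]
  rw [WeightedGraph.phase, WeightedGraph.phase, ← Finset.sum_sub_distrib,
    ← Finset.sum_subset hsub hzero, Finset.sum_image hinj, hP, Finset.sum_sigma]
  refine Finset.sum_congr rfl fun k _ => ?_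
  rw [WeightedGraph.angle, Finset.mul_sum]
  refine Finset.sum_congr rfl fun j _ => ?_
  simp only [pairBit, Sym2.lift_mk, ← h j.1 j.2]
  ring

/-- The gate shifts the phases of an adaptive test by the angles of the graph. -/
theorem WeightedGraph.adaptiveTest_eq_conj (G : WeightedGraph V) {B : Finset V}
    (hB : G.graph.IsIndepSet (B : Set V)) (a : ({j : V // j ∉ B} → Fin 2) → V → ℝ) :
    adaptiveTest B (fun z v => ketBra (phaseKet (a z v))) =
      G.gate * adaptiveTest B (fun z v => ketBra (phaseKet (a z v - G.angle B z v))) *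
        G.gateᴴ := by
  ext x y
  rw [G.conjTranspose_gate_apply, Matrix.mul_diagonal, WeightedGraph.gate, Matrix.diagonal_mul]
  by_cases h : ∀ v ∉ B, x v = y v
  · rw [adaptiveTest_apply_of_agree B _ h, adaptiveTest_apply_of_agree B _ h]
    simp only [ketBra_phaseKet_apply, Finset.prod_mul_distrib, ← Complex.exp_sum]
    -- Inside a block, both sides carry the same power of `1/2`, so the claim is an identity of
    -- exponents: the phase difference from `phase_sub_phase` compensates the shift of the angles.
    have e : ∑ v ∈ B, Complex.I * ((((((x v : ℕ) : ℝ) - ((y v : ℕ) : ℝ)) *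
        a (fun j => x j.1) v : ℝ)) : ℂ) = Complex.I * (G.phase x : ℂ) +
        ∑ v ∈ B, Complex.I * ((((((x v : ℕ) : ℝ) - ((y v : ℕ) : ℝ)) *
        (a (fun j => x j.1) v - G.angle B (fun j => x j.1) v) : ℝ)) : ℂ) +
        -(Complex.I * (G.phase y : ℂ)) := by
      have hs := G.phase_sub_phase hB h
      rw [← Finset.mul_sum, ← Finset.mul_sum, ← Complex.ofReal_sum, ← Complex.ofReal_sum,
        ← mul_add, ← Complex.ofReal_add, ← mul_neg, ← mul_add, ← Complex.ofReal_neg,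
        ← Complex.ofReal_add]
      congr 2
      simp only [mul_sub, Finset.sum_sub_distrib]
      rw [← hs]
      ring
    rw [e, Complex.exp_add, Complex.exp_add]
    ring
  · push Not at h
    obtain ⟨v, hv, hne⟩ := h
    rw [adaptiveTest_apply_of_disagree B _ hv hne, adaptiveTest_apply_of_disagree B _ hv hne]
    simp

theorem WeightedGraph.coverTest_eq_adaptiveTest (G : WeightedGraph V) (h : ℕ) (B : Finset V) :
    G.coverTest h B =
      adaptiveTest B fun z v => ketBra (phaseKet (roundAngle h (G.angle B z v))) :=
  rfl

theorem abs_roundAngle_sub_div_two_le {h : ℕ} (hh : 0 < h) (α : ℝ) :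
    |(roundAngle h α - α) / 2| ≤ Real.pi / (4 * h) := by
  obtain ⟨h1, h2⟩ := roundAngle_spec hh α
  have e : Real.pi / (2 * h) = 2 * (Real.pi / (4 * h)) := by
    field_simp
    norm_num
  rw [abs_le]
  constructor <;> linarith

theorem pi_div_four_mul_le {h : ℕ} (hh : 0 < h) : Real.pi / (4 * h) ≤ Real.pi / 2 := by
  have : (1 : ℝ) ≤ h := by exact_mod_cast hh
  exact div_le_div_of_nonneg_left Real.pi_pos.le (by norm_num) (by linarith)

theorem sin_pi_div_four_mul_nonneg {h : ℕ} (hh : 0 < h) : 0 ≤ Real.sin (Real.pi / (4 * h)) :=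
  Real.sin_nonneg_of_nonneg_of_le_pi (by positivity)
    ((pi_div_four_mul_le hh).trans (by linarith [Real.pi_pos]))

/-- Half the rounding error is at most `π/(4h) ≤ π/2`, within the range where sine is increasing. -/
theorem abs_sin_roundAngle_sub_le {h : ℕ} (hh : 0 < h) (α : ℝ) :
    |Real.sin ((roundAngle h α - α) / 2)| ≤ Real.sin (Real.pi / (4 * h)) := by
  have h1 := abs_le.mp (abs_roundAngle_sub_div_two_le hh α)
  have h2 := pi_div_four_mul_le hh
  rw [abs_le, ← Real.sin_neg]
  exact ⟨Real.sin_le_sin_of_le_of_le_pi_div_two (by linarith) (by linarith) h1.1,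
    Real.sin_le_sin_of_le_of_le_pi_div_two (by linarith) h2 h1.2⟩

theorem WeightedGraph.coverTest_nonneg (G : WeightedGraph V) (h : ℕ) (B : Finset V) :
    0 ≤ G.coverTest h B := by
  rw [G.coverTest_eq_adaptiveTest]
  exact adaptiveTest_nonneg B fun z v => ketBra_nonneg _

theorem WeightedGraph.coverTest_le_one (G : WeightedGraph V) (h : ℕ) (B : Finset V) :
    G.coverTest h B ≤ 1 := by
  rw [G.coverTest_eq_adaptiveTest]
  exact adaptiveTest_le_one B (fun z v => ketBra_nonneg _) fun z v =>
    (isStarProjection_ketBra_phaseKet _).le_one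

/-- The rounded test is close to the exact stabilizer test. -/
theorem WeightedGraph.coverTest_le (G : WeightedGraph V) {h : ℕ} (hh : 0 < h) {B : Finset V}
    (hB : G.graph.IsIndepSet (B : Set V)) :
    G.coverTest h B ≤ G.gate * plusProj B * G.gateᴴ +
      ((B.card * Real.sin (Real.pi / (4 * h)) : ℝ) : ℂ) • 1 := by
  have hle := adaptiveTest_le_add B (sin_pi_div_four_mul_nonneg hh)
    (a := fun z v => ketBra (phaseKet (roundAngle h (G.angle B z v) - G.angle B z v)))
    (b := fun _ _ => ketBra plusKet)
    (fun z v => isStarProjection_ketBra_phaseKet _) (fun z v => isStarProjection_plusKet)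
    fun z v => ketBra_phaseKet_sub_plusKet_le (abs_sin_roundAngle_sub_le hh _)
  -- The comparison test aims at `|+⟩` whatever `z` is, so it is the projection `plusProj B`.
  rw [adaptiveTest_const] at hle
  have hconj := star_right_conjugate_le_conjugate hle G.gate
  rw [G.coverTest_eq_adaptiveTest, G.adaptiveTest_eq_conj hB]
  rw [Matrix.star_eq_conjTranspose, mul_add, add_mul, Matrix.mul_smul, Matrix.smul_mul, mul_one,
    G.gate_mul_conjTranspose] at hconj
  exact hconj

/-- The acceptance probability of the graph state in one of the tests. -/
theorem WeightedGraph.trace_coverTest_mul_state (G : WeightedGraph V) {h : ℕ} (hh : 0 < h)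
    {B : Finset V} (hB : G.graph.IsIndepSet (B : Set V)) :
    ∃ t : ℝ, (G.coverTest h B * ketBra G.state).trace = (t : ℂ) ∧
      (1 - Real.sin (Real.pi / (4 * h)) ^ 2) ^ B.card ≤ t := by
  obtain ⟨t, ht, hle⟩ := trace_adaptiveTest_mul_plus B
    (fun z v => roundAngle h (G.angle B z v) - G.angle B z v)
    (c := 1 - Real.sin (Real.pi / (4 * h)) ^ 2)
    (by linarith [Real.sin_sq_le_one (Real.pi / (4 * h))])
    fun z v _ => by
      rw [Real.cos_sq']
      have := sq_le_sq.mpr ((abs_sin_roundAngle_sub_le hh (G.angle B z v)).trans (le_abs_self _))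
      linarith
  refine ⟨t, ?_, hle⟩
  rw [← ht, G.coverTest_eq_adaptiveTest, G.adaptiveTest_eq_conj hB, G.ketBra_state]
  have e : plusProj (Finset.univ : Finset V) = tensorOp fun _ => ketBra plusKet := by
    simp [plusProj]
  rw [e]
  generalize adaptiveTest B _ = T
  generalize (tensorOp fun _ => ketBra plusKet : Matrix (V → Fin 2) (V → Fin 2) ℂ) = R
  calc (G.gate * T * G.gateᴴ * (G.gate * R * G.gateᴴ)).trace
      = (G.gate * (T * (G.gateᴴ * G.gate) * R * G.gateᴴ)).trace := by simp only [mul_assoc]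
    _ = (T * R * (G.gateᴴ * G.gate)).trace := by
      rw [Matrix.trace_mul_comm, G.conjTranspose_gate_mul, mul_one, mul_assoc,
        G.conjTranspose_gate_mul]
    _ = (T * R).trace := by rw [G.conjTranspose_gate_mul, mul_one]

theorem smul_testOperator (G : WeightedGraph V) (h : ℕ) {m : ℕ} (hm : 0 < m)
    (A : Fin m → Finset V) :
    ((m : ℝ) : ℂ) • G.testOperator h A = ∑ l, G.coverTest h (A l) := by
  have : (m : ℂ) ≠ 0 := by exact_mod_cast hm.ne'
  rw [WeightedGraph.testOperator, smul_smul, Complex.ofReal_natCast, mul_one_div_cancel this,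
    one_smul]

theorem one_div_natCast_nonneg (m : ℕ) : (0 : ℂ) ≤ 1 / (m : ℂ) := by
  rw [← Complex.ofReal_natCast, ← Complex.ofReal_one, ← Complex.ofReal_div]
  exact Complex.zero_le_real.mpr (by positivity)

theorem WeightedGraph.testOperator_nonneg (G : WeightedGraph V) (h : ℕ) {m : ℕ}
    (A : Fin m → Finset V) : 0 ≤ G.testOperator h A :=
  smul_nonneg (one_div_natCast_nonneg m) (Finset.sum_nonneg fun l _ => G.coverTest_nonneg h (A l))

theorem WeightedGraph.testOperator_le_one (G : WeightedGraph V) (h : ℕ) {m : ℕ} (hm : 0 < m)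
    (A : Fin m → Finset V) : G.testOperator h A ≤ 1 := by
  have hm' : (m : ℂ) ≠ 0 := by exact_mod_cast hm.ne'
  have h1 := smul_le_smul_of_nonneg_left
    (Finset.sum_le_sum fun l (_ : l ∈ Finset.univ) => G.coverTest_le_one h (A l))
    (one_div_natCast_nonneg m)
  refine h1.trans (le_of_eq ?_)
  rw [Finset.sum_const, Finset.card_univ, Fintype.card_fin, ← Nat.cast_smul_eq_nsmul ℂ, smul_smul,
    one_div_mul_cancel hm', one_smul]

theorem IsIndependenceCover.biUnion_eq {G : WeightedGraph V} {m : ℕ} {A : Fin m → Finset V}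
    (hA : IsIndependenceCover G A) : Finset.univ.biUnion A = Finset.univ := by
  ext v
  simpa using hA.cover v

/-- Disjointness is what makes the errors `|A_l| s` of the separate tests add up to `n s`. -/
theorem IsIndependenceCover.sum_card {G : WeightedGraph V} {m : ℕ} {A : Fin m → Finset V}
    (hA : IsIndependenceCover G A) : ∑ l, (A l).card = Fintype.card V := by
  rw [← Finset.card_univ, ← hA.biUnion_eq, Finset.card_biUnion fun l _ l' _ h => hA.disjoint l l' h]

/-- The spectral gap of the test operator, up to the rounding error. -/
theorem one_sub_ketBra_state_le {G : WeightedGraph V} {m : ℕ} (hm : 0 < m) {A : Fin m → Finset V}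
    (hA : IsIndependenceCover G A) {h : ℕ} (hh : 0 < h) :
    1 - ketBra G.state ≤ ((m : ℝ) : ℂ) • (1 - G.testOperator h A) +
      ((Fintype.card V * Real.sin (Real.pi / (4 * h)) : ℝ) : ℂ) • 1 := by
  -- The union bound is proved for `|+⟩^{⊗ n}` and transported to the graph state by conjugation
  -- with the gate.
  have hu := star_right_conjugate_le_conjugate
    (one_sub_plusProj_biUnion_le Finset.univ A) G.gate
  rw [hA.biUnion_eq, Matrix.star_eq_conjTranspose, mul_sub, sub_mul, mul_one,
    G.gate_mul_conjTranspose, ← G.ketBra_state, Finset.mul_sum, Finset.sum_mul] at hu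
  refine hu.trans ?_
  have hl : ∀ l, G.gate * (1 - plusProj (A l)) * G.gateᴴ ≤ (1 - G.coverTest h (A l)) +
      (((A l).card * Real.sin (Real.pi / (4 * h)) : ℝ) : ℂ) • 1 := fun l => by
    have hc := G.coverTest_le hh (hA.indep l)
    rw [mul_sub, sub_mul, mul_one, G.gate_mul_conjTranspose, sub_add_eq_add_sub,
      sub_le_sub_iff, add_assoc]
    rw [add_comm (((((A l).card * Real.sin (Real.pi / (4 * h)) : ℝ) : ℂ)) • _)]
    gcongr
  refine (Finset.sum_le_sum fun l _ => hl l).trans (le_of_eq ?_)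
  rw [Finset.sum_add_distrib, smul_sub, smul_testOperator G h hm, Finset.sum_sub_distrib,
    ← Finset.sum_smul, ← Complex.ofReal_sum, ← Finset.sum_mul, ← Nat.cast_sum, hA.sum_card]
  congr 2
  rw [Finset.sum_const, Finset.card_univ, Fintype.card_fin, ← Nat.cast_smul_eq_nsmul ℂ,
    Complex.ofReal_natCast]

end GraphState

/-! ### Completeness and soundness of the verification -/

theorem theorem2 {V : Type*} [Fintype V] [DecidableEq V] (G : WeightedGraph V)
    {m : ℕ} (hm : 0 < m) (A : Fin m → Finset V) (hA : IsIndependenceCover G A)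
    (h : ℕ) (hh : 0 < h) (N : ℕ) (hN : 0 < N) (β : ℝ) (hβ : 1 / ((N : ℝ) + 1) ≤ β) :
    (1 - Real.sin (Real.pi / (4 * h)) ^ 2) ^ (N * Finset.univ.sup fun l => (A l).card) ≤
        passProb (G.testOperator h A) (tensorOp fun _ : Fin (N + 1) => ketBra G.state) ∧
      GuaranteesWithSignificance N (G.testOperator h A) β fun σ =>
        1 - (m * (1 - β) / (β * N) + Fintype.card V * Real.sin (Real.pi / (4 * h))) ≤
          fidelity G.state σ := by
  have hβ0 : 0 < β := lt_of_lt_of_le (by positivity) hβ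
  constructor
  · choose t ht htle using fun l => G.trace_coverTest_mul_state hh (hA.indep l)
    have hmR : (0 : ℝ) < m := by exact_mod_cast hm
    set c := 1 - Real.sin (Real.pi / (4 * h)) ^ 2 with hc
    have hc0 : 0 ≤ c := by linarith [Real.sin_sq_le_one (Real.pi / (4 * h))]
    have hc1 : c ≤ 1 := by linarith [sq_nonneg (Real.sin (Real.pi / (4 * h)))]
    have htr : (G.testOperator h A * ketBra G.state).trace =
        ((1 / (m : ℝ) * ∑ l, t l : ℝ) : ℂ) := by
      rw [WeightedGraph.testOperator, Matrix.smul_mul, Matrix.trace_smul, Finset.sum_mul,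
        Matrix.trace_sum, Finset.sum_congr rfl fun l _ => ht l]
      push_cast
      rfl
    rw [passProb_tensorOp_ketBra _ G.trace_ketBra_state htr, mul_comm N, pow_mul]
    refine pow_le_pow_left₀ (pow_nonneg hc0 _) ?_ N
    -- Since `0 ≤ c ≤ 1`, the largest `A l` gives the smallest of the bounds `c ^ |A_l|`, so it
    -- bounds the average as well.
    have hsum : m • c ^ (Finset.univ.sup fun l => (A l).card) ≤ ∑ l, t l := by
      have := Finset.card_nsmul_le_sum Finset.univ t
        (c ^ (Finset.univ.sup fun l => (A l).card)) fun l _ =>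
          (pow_le_pow_of_le_one hc0 hc1
            (Finset.le_sup (f := fun l => (A l).card) (Finset.mem_univ l))).trans (htle l)
      simpa using this
    rw [nsmul_eq_mul] at hsum
    rw [one_div_mul_eq_div, le_div_iff₀ hmR]
    linarith
  · intro ρ hρ hp
    exact fidelity_resultantState_ge (G.testOperator_nonneg h A) (G.testOperator_le_one h hm A) hN
      hβ0 hρ hp (Nat.cast_nonneg m) (one_sub_ketBra_state_le hm hA hh)
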